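/- Let $p\in\{0,1,2,\dots\}\cup\{\infty\}$ and let $X$ be an infinite-dimensional real Banach space. Call a closed set $A\subseteq X$ a $C^p$ smooth starlike body if there is a point $x_0$ in the interior of $A$ such that each ray $\{x_0+tv : t\ge 0\}$, $v\in X\setminus\{0\}$, meets the boundary $\partial A$ in at most one point, and such that the Minkowski functional $q(v)=\inf\{\lambda>0 : x_0+\lambda^{-1}v\in A\}$ is $C^p$ smooth (in the Fréchet sense; continuous if $p=0$) on $X\setminus q^{-1}(0)$. A map defined on a subset $S$ of a Banach space is called $C^p$ smooth if it is the restriction to $S$ of a $C^p$ map defined on an open set containing $S$. Let $A$ be a bounded $C^p$ smooth starlike body in $X$. Then: 1. The boundary $\partial A$ is $C^p$ contractible: there are a point $c\in\partial A$ and a $C^p$ smooth map $H:[0,1]\times\partial A\to\partial A$ such that $H(0,x)=x$ and $H(1,x)=c$ for all $x\in\partial A$. 2. There is a $C^p$ smooth retraction of $A$ onto $\partial A$, that is, a $C^p$ smooth map $R:A\to\partial A$ with $R(x)=x$ for all $x\in\partial A$. 3. There is a $C^p$ smooth map $\varphi:A\to A$ without fixed points. -/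

import Mathlib

/-- The closed ray `{x₀ + t v : t ≥ 0}` emanating from `x₀` in the direction `v`. -/
def rayFrom {X : Type*} [NormedAddCommGroup X] [NormedSpace ℝ X] (x₀ v : X) : Set X :=
  (fun t : ℝ => x₀ + t • v) '' Set.Ici 0

/-- `A` is a starlike body with respect to `x₀`: it is closed, `x₀` is an interior point, and
each ray emanating from `x₀` meets the boundary of `A` at most once. -/
structure IsStarlikeBodyWrt {X : Type*} [NormedAddCommGroup X] [NormedSpace ℝ X]
    (A : Set X) (x₀ : X) : Prop where
  isClosed : IsClosed A
  mem_interior : x₀ ∈ interior A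
  ray_inter : ∀ v : X, (rayFrom x₀ v ∩ frontier A).Subsingleton

/-- The Minkowski functional of `A` with respect to the centre `x₀`, that is, the usual
Minkowski functional `v ↦ inf {r > 0 | r⁻¹ v ∈ A - x₀}` of the translate `A - x₀`. -/
noncomputable def minkowskiAt {X : Type*} [NormedAddCommGroup X] [NormedSpace ℝ X]
    (A : Set X) (x₀ : X) : X → ℝ :=
  gauge {v : X | x₀ + v ∈ A}

/-- `A` is a `C^p` smooth starlike body: for some centre `x₀` it is a starlike body whose
Minkowski functional `q` is `C^p` (in the Fréchet sense) on the open set `{v | q v ≠ 0}`. -/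
def IsSmoothStarlikeBody {X : Type*} [NormedAddCommGroup X] [NormedSpace ℝ X]
    (p : ℕ∞) (A : Set X) : Prop :=
  ∃ x₀ : X, IsStarlikeBodyWrt A x₀ ∧
    ContDiffOn ℝ p (minkowskiAt A x₀) {v : X | minkowskiAt A x₀ v ≠ 0}

/-- `f` is of class `C^p` on a (not necessarily open) set `S`: it is defined and `C^p` on some
open neighbourhood of `S`. As `f` is a total function whose values off `S` are otherwise
irrelevant, this says that its restriction to `S` extends to a `C^p` map on an open set. -/
def IsCpOn {E F : Type*} [NormedAddCommGroup E] [NormedSpace ℝ E]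
    [NormedAddCommGroup F] [NormedSpace ℝ F] (p : ℕ∞) (f : E → F) (S : Set E) : Prop :=
  ∃ U : Set E, IsOpen U ∧ S ⊆ U ∧ ContDiffOn ℝ p f U

/-- `S` is `C^p` contractible: there is a `C^p` homotopy `H : [0,1] × S → S` joining the identity
of `S` to a constant map. -/
def IsCpContractible {X : Type*} [NormedAddCommGroup X] [NormedSpace ℝ X]
    (p : ℕ∞) (S : Set X) : Prop :=
  ∃ (H : ℝ × X → X) (c : X), c ∈ S ∧
    IsCpOn p H (Set.Icc (0 : ℝ) 1 ×ˢ S) ∧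
    Set.MapsTo H (Set.Icc (0 : ℝ) 1 ×ˢ S) S ∧
    (∀ x ∈ S, H (0, x) = x) ∧
    (∀ x ∈ S, H (1, x) = c)

/-- `R` is a `C^p` retraction of `A` onto its subset `S`. -/
structure IsCpRetraction {X : Type*} [NormedAddCommGroup X] [NormedSpace ℝ X]
    (p : ℕ∞) (R : X → X) (A S : Set X) : Prop where
  subset : S ⊆ A
  smooth : IsCpOn p R A
  mapsTo : Set.MapsTo R A S
  fixes : ∀ x ∈ S, R x = x

open Set Filter Topology Metric

/-! Everything reduces to a nowhere vanishing `C^p` map `f` equal to the identity off a ball: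
rescaled and radially projected, it gives a retraction `R` of the whole space onto the boundary.
Take `f x = x - γ (s x)`, where `γ` is a path from `0` and `s ≥ 0` satisfies `t < s (γ t)`. A zero
would be `x = γ t` with `t = s x`, whence `s (γ t) = t`, a contradiction. Such an `s` must blow up
along a bounded path, which is possible because infinite dimension lets the segments of `γ` stay
uniformly apart (`exists_seq_separated_segments`). It is a locally finite sum of bumps, supplied by
the Minkowski functional (`IsStarlikeBodyWrt.hasCpBump`). Contracting linearly to the centre and
then applying `R` gives the homotopy; following `R` by a radial antipode removes fixed points. -/

/-- A normed space has `C^p` bumps if there is a nonnegative `C^p` function with values equal to `1`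
near the origin and vanishing outside the open unit ball. -/
def HasCpBump (X : Type*) [NormedAddCommGroup X] [NormedSpace ℝ X] (p : ℕ∞) : Prop :=
  ∃ b : X → ℝ, ContDiff ℝ p b ∧ (∀ x, 0 ≤ b x) ∧ (∀ᶠ x in 𝓝 0, b x = 1) ∧
    ∀ x, b x ≠ 0 → ‖x‖ < 1

theorem contDiff_finsum_of_locallyFinite {E F : Type*} [NormedAddCommGroup E] [NormedSpace ℝ E]
    [NormedAddCommGroup F] [NormedSpace ℝ F] {ι : Type*} {p : ℕ∞} {f : ι → E → F}
    (hf : ∀ i, ContDiff ℝ p (f i)) (hfin : LocallyFinite fun i => Function.support (f i)) :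
    ContDiff ℝ p fun x => ∑ᶠ i, f i x := by
  rw [contDiff_iff_contDiffAt]
  intro x
  obtain ⟨I, hI⟩ := finsum_eventually_eq_sum hfin x
  exact (ContDiff.sum fun i _ => hf i).contDiffAt.congr_of_eventuallyEq hI

theorem IsPreconnected.inter_frontier_nonempty {α : Type*} [TopologicalSpace α] {s t : Set α}
    (hs : IsPreconnected s) (ht : (s ∩ t).Nonempty) (ht' : (s ∩ tᶜ).Nonempty) :
    (s ∩ frontier t).Nonempty := by
  by_contra hempty
  have hfr : ∀ x ∈ s, x ∉ frontier t := fun x hx hxt => hempty ⟨x, hx, hxt⟩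
  obtain ⟨x, hxs, hxt⟩ := ht
  obtain ⟨y, hys, hyt⟩ := ht'
  have hint : ∀ z ∈ s, z ∈ closure t → z ∈ interior t := fun z hz hzt => by
    by_contra h
    exact hfr z hz ⟨hzt, h⟩
  refine hyt (interior_subset (hs.subset_left_of_subset_union (v := (closure t)ᶜ) isOpen_interior
    isClosed_closure.isOpen_compl ?_ ?_ ⟨x, hxs, hint x hxs (subset_closure hxt)⟩ hys))
  · exact disjoint_compl_right_iff_subset.2 (interior_subset.trans subset_closure)
  · exact fun z hz => or_iff_not_imp_right.2 fun h => hint z hz (not_not.1 h)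

/-! ### Escaping paths and nowhere vanishing maps. -/

section Path

variable {X : Type*} [NormedAddCommGroup X] [NormedSpace ℝ X]

/-- In an infinite-dimensional space there is a bounded sequence starting at `0` each of whose
later terms is at distance at least `1` from a flag containing the previous terms. -/
theorem exists_seq_one_le_norm_sub_flag (hX : ¬ FiniteDimensional ℝ X) :
    ∃ (y : ℕ → X) (F : ℕ → Submodule ℝ X), y 0 = 0 ∧ Monotone F ∧ (∀ n, y n ∈ F n) ∧
      (∀ n, ‖y n‖ ≤ 3) ∧ ∀ m n, m < n → ∀ z ∈ F m, 1 ≤ ‖y n - z‖ := by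
  obtain ⟨f, hf, hr⟩ := exists_seq_of_forall_finset_exists
    (fun a : X × Submodule ℝ X => FiniteDimensional ℝ a.2 ∧ a.1 ∈ a.2 ∧ ‖a.1‖ ≤ 3)
    (fun a b => a.2 ≤ b.2 ∧ ∀ z ∈ a.2, 1 ≤ ‖b.1 - z‖) (by
      intro s hs
      set G : Submodule ℝ X := s.sup Prod.snd with hG
      have hfin : FiniteDimensional ℝ G :=
        Finset.sup_induction (p := fun S : Submodule ℝ X => FiniteDimensional ℝ S)
          (finiteDimensional_bot ℝ X)
          (fun _ _ _ _ => inferInstance) fun a ha => (hs a ha).1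
      have hne : ∃ x, x ∉ G := by
        by_contra! h
        have htop : G = ⊤ := by
          ext x
          simp [h x]
        rw [htop] at hfin
        exact hX (Submodule.topEquiv.finiteDimensional)
      obtain ⟨x, hx, hxG⟩ := riesz_lemma_of_norm_lt (𝕜 := ℝ) (c := 2) (R := 3) (by norm_num)
        (by norm_num) G.closed_of_finiteDimensional hne
      have hle : ∀ a ∈ s, a.2 ≤ G := fun a ha => Finset.le_sup (f := Prod.snd) ha
      refine ⟨(x, G ⊔ Submodule.span ℝ {x}), ⟨?_, ?_, hx⟩, fun a ha => ⟨?_, ?_⟩⟩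
      · dsimp only
        infer_instance
      · exact Submodule.mem_sup_right (Submodule.mem_span_singleton_self x)
      · exact (hle a ha).trans le_sup_left
      · exact fun z hz => hxG z (hle a ha hz))
  -- Resetting term `0` to the origin is harmless: separation concerns only terms of index `n > m ≥
  -- 0`.
  refine ⟨fun n => if n = 0 then 0 else (f n).1, fun n => (f n).2, by simp, ?_, ?_, ?_, ?_⟩
  · exact monotone_nat_of_le_succ fun n => (hr n (n + 1) n.lt_succ_self).1
  · intro n
    dsimp only
    split_ifs
    · exact zero_mem _
    · exact (hf n).2.1
  · intro n
    dsimp only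
    split_ifs
    · simp
    · exact (hf n).2.2
  · intro m n hmn z hz
    have : n ≠ 0 := by lia
    simpa [this] using (hr m n hmn).2 z hz

/-- There is a polygonal path starting at the origin, bounded, whose non-consecutive segments are
uniformly separated. -/
theorem exists_seq_separated_segments (hX : ¬ FiniteDimensional ℝ X) :
    ∃ y : ℕ → X, y 0 = 0 ∧ (∀ n, ‖y n‖ ≤ 3) ∧
      ∀ m n, m + 2 ≤ n → ∀ a ∈ segment ℝ (y m) (y (m + 1)), ∀ b ∈ segment ℝ (y n) (y (n + 1)),
        1 / 8 ≤ dist a b := by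
  obtain ⟨y, F, h0, hF, hy, hn, hsep⟩ := exists_seq_one_le_norm_sub_flag hX
  refine ⟨y, h0, hn, fun m n hmn a ha b hb => ?_⟩
  have haF : a ∈ F (m + 1) :=
    (F (m + 1)).convex.segment_subset (hF m.le_succ (hy m)) (hy (m + 1)) ha
  obtain ⟨u, θ, hu, hθ, huθ, rfl⟩ := hb
  rw [dist_comm, dist_eq_norm]
  -- For `θ ≥ 1/8` the gap between `y (n + 1)` and `F n` gives distance at least `θ`. Otherwise the
  -- gap between `y n` and `F (m + 1)` gives at least `u - 3θ > 7/8 - 3/8`.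
  rcases le_or_gt (1 / 8) θ with h | h
  · have hθ0 : θ ≠ 0 := by linarith
    have hz : θ⁻¹ • (a - u • y n) ∈ F n :=
      (F n).smul_mem _ (sub_mem (hF (by lia) haF) ((F n).smul_mem _ (hy n)))
    have h1 := hsep n (n + 1) n.lt_succ_self _ hz
    have e : u • y n + θ • y (n + 1) - a = θ • (y (n + 1) - θ⁻¹ • (a - u • y n)) := by
      rw [smul_sub, smul_inv_smul₀ hθ0]
      abel
    rw [e, norm_smul, Real.norm_of_nonneg hθ]
    nlinarith
  · have hu0 : u ≠ 0 := by linarith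
    have hz : u⁻¹ • a ∈ F (m + 1) := (F (m + 1)).smul_mem _ haF
    have h1 := hsep (m + 1) n (by lia) _ hz
    have e : u • (y n - u⁻¹ • a) = (u • y n + θ • y (n + 1) - a) - θ • y (n + 1) := by
      rw [smul_sub, smul_inv_smul₀ hu0]
      abel
    have h2 := norm_sub_le (u • y n + θ • y (n + 1) - a) (θ • y (n + 1))
    rw [← e, norm_smul, norm_smul, Real.norm_of_nonneg hθ, Real.norm_of_nonneg hu] at h2
    nlinarith [hn (n + 1), norm_nonneg (y (n + 1))]

/-- A smooth parametrization of the polygonal path with vertices `y 0 = 0, y 1, y 2, …`. -/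
theorem exists_contDiff_path (p : ℕ∞) (y : ℕ → X) (h0 : y 0 = 0) :
    ∃ γ : ℝ → X, ContDiff ℝ p γ ∧ γ 0 = 0 ∧
      ∀ t, 0 ≤ t → γ t ∈ segment ℝ (y ⌊t⌋₊) (y (⌊t⌋₊ + 1)) := by
  have hsupp : ∀ (k : ℕ) (t : ℝ), t ≤ k →
      Real.smoothTransition (t - k) • (y (k + 1) - y k) = 0 := fun k t h => by
    rw [Real.smoothTransition.zero_of_nonpos (by linarith), zero_smul]
  -- The `k`-th increment is switched on during `[k, k + 1]`; completed increments telescope, and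
  -- the active one carries a weight in `[0, 1]`.
  refine ⟨fun t => ∑ᶠ k : ℕ, Real.smoothTransition (t - k) • (y (k + 1) - y k), ?_, ?_, ?_⟩
  · refine contDiff_finsum_of_locallyFinite (fun k => ?_) ?_
    · exact (Real.smoothTransition.contDiff.comp (contDiff_id.sub contDiff_const)).smul
        contDiff_const
    · intro t
      refine ⟨Iio (t + 1), Iio_mem_nhds (by linarith), ?_⟩
      refine (finite_Iio ⌈t + 1⌉₊).subset ?_
      rintro k ⟨u, hu, hut⟩
      by_contra hk
      refine hu (hsupp k u ?_)
      have : (⌈t + 1⌉₊ : ℝ) ≤ k := by exact_mod_cast not_lt.1 hk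
      exact (mem_Iio.1 hut).le.trans ((Nat.le_ceil _).trans this)
  · exact finsum_eq_zero_of_forall_eq_zero fun k => hsupp k 0 k.cast_nonneg
  · intro t ht
    set n := ⌊t⌋₊ with hn
    have hnt : (n : ℝ) ≤ t := Nat.floor_le ht
    have htn : t < n + 1 := Nat.lt_floor_add_one t
    have hsum : ∑ᶠ k : ℕ, Real.smoothTransition (t - k) • (y (k + 1) - y k) =
        ∑ k ∈ Finset.range (n + 1), Real.smoothTransition (t - k) • (y (k + 1) - y k) := by
      refine finsum_eq_sum_of_support_subset _ fun k hk => ?_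
      by_contra hkn
      refine hk (hsupp k t ?_)
      have : ((n + 1 : ℕ) : ℝ) ≤ k := by
        exact_mod_cast (by simpa using hkn : n + 1 ≤ k)
      push_cast at this
      linarith
    have hone : ∀ k ∈ Finset.range n,
        Real.smoothTransition (t - k) • (y (k + 1) - y k) = y (k + 1) - y k := by
      intro k hk
      have : ((k + 1 : ℕ) : ℝ) ≤ n := by exact_mod_cast Finset.mem_range.1 hk
      push_cast at this
      rw [Real.smoothTransition.one_of_one_le (by linarith), one_smul]
    dsimp only
    rw [hsum, Finset.sum_range_succ, Finset.sum_congr rfl hone, Finset.sum_range_sub, h0, sub_zero,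
      segment_eq_image']
    exact ⟨_, ⟨Real.smoothTransition.nonneg _, Real.smoothTransition.le_one _⟩, rfl⟩

/-- Compactness reduces this to finitely many rescaled bumps; nonnegativity preserves the lower
bounds under addition. -/
theorem exists_contDiff_le_on_compact {p : ℕ∞} (hb : HasCpBump X p) {K : Set X} (hK : IsCompact K)
    {r : ℝ} (hr : 0 < r) {C : ℝ} (hC : 0 ≤ C) :
    ∃ s : X → ℝ, ContDiff ℝ p s ∧ (∀ x, 0 ≤ s x) ∧ (∀ x ∈ K, C ≤ s x) ∧
      ∀ x, s x ≠ 0 → ∃ y ∈ K, dist x y < r := by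
  obtain ⟨b, hbd, hb0, hb1, hbs⟩ := hb
  refine hK.induction_on (p := fun T => ∃ s : X → ℝ, ContDiff ℝ p s ∧ (∀ x, 0 ≤ s x) ∧
    (∀ x ∈ T, C ≤ s x) ∧ ∀ x, s x ≠ 0 → ∃ y ∈ K, dist x y < r) ?_ ?_ ?_ ?_
  · exact ⟨0, contDiff_const, by simp, by simp, by simp⟩
  · rintro T T' hT ⟨s, h1, h2, h3, h4⟩
    exact ⟨s, h1, h2, fun x hx => h3 x (hT hx), h4⟩
  · rintro T T' ⟨s, h1, h2, h3, h4⟩ ⟨s', h1', h2', h3', h4'⟩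
    refine ⟨fun x => s x + s' x, h1.add h1', fun x => add_nonneg (h2 x) (h2' x), ?_, ?_⟩
    · rintro x (hx | hx)
      · exact (h3 x hx).trans (le_add_of_nonneg_right (h2' x))
      · exact (h3' x hx).trans (le_add_of_nonneg_left (h2 x))
    · intro x hx
      by_cases h : s x = 0
      · exact h4' x fun h' => hx (by simp [h, h'])
      · exact h4 x h
  · intro y hy
    have hcont : Continuous fun x : X => r⁻¹ • (x - y) := by fun_prop
    have hnhds : ∀ᶠ x in 𝓝 y, b (r⁻¹ • (x - y)) = 1 := by
      have := hcont.tendsto y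
      rw [sub_self, smul_zero] at this
      exact this.eventually hb1
    refine ⟨_, mem_nhdsWithin_of_mem_nhds hnhds, fun x => C * b (r⁻¹ • (x - y)), ?_, ?_, ?_, ?_⟩
    · exact contDiff_const.mul
        (hbd.comp (contDiff_const.smul (contDiff_id.sub contDiff_const)))
    · exact fun x => mul_nonneg hC (hb0 _)
    · intro x hx
      have hx' : b (r⁻¹ • (x - y)) = 1 := hx
      dsimp only
      rw [hx', mul_one]
    · intro x hx
      refine ⟨y, hy, ?_⟩
      have := hbs _ (right_ne_zero_of_mul hx)
      rwa [norm_smul, norm_inv, Real.norm_of_nonneg hr.le, inv_mul_lt_iff₀ hr, mul_one,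
        ← dist_eq_norm] at this

/-- In an infinite-dimensional space with `C^p` bumps there is a nowhere vanishing `C^p` map that
is the identity off a ball. -/
theorem exists_contDiff_ne_zero_eq_self (hX : ¬ FiniteDimensional ℝ X) {p : ℕ∞}
    (hb : HasCpBump X p) :
    ∃ f : X → X, ContDiff ℝ p f ∧ (∀ x, f x ≠ 0) ∧ ∀ x, 4 ≤ ‖x‖ → f x = x := by
  obtain ⟨y, h0, hy, hsep⟩ := exists_seq_separated_segments hX
  obtain ⟨γ, hγ, hγ0, hγm⟩ := exists_contDiff_path p y h0
  have hK : ∀ n, IsCompact (segment ℝ (y n) (y (n + 1))) := fun n => by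
    rw [segment_eq_image']
    exact isCompact_Icc.image (by fun_prop)
  have hpos : ∀ n : ℕ, (0 : ℝ) ≤ n + 2 := fun n => by positivity
  choose s hs1 hs2 hs3 hs4 using fun n : ℕ =>
    exists_contDiff_le_on_compact hb (hK n) (r := 1 / 32) (by norm_num) (hpos n)
  have hfin : LocallyFinite fun n => Function.support (s n) := by
    intro z
    -- Two supports meeting this ball bring their segments within `4 * (1/32) = 1/8`, so no index
    -- beyond `m + 1` occurs.
    refine ⟨ball z (1 / 32), ball_mem_nhds z (by norm_num), ?_⟩
    rcases Set.eq_empty_or_nonempty {n | (Function.support (s n) ∩ ball z (1 / 32)).Nonempty}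
      with h | ⟨m, u, hu, huz⟩
    · rw [h]
      exact finite_empty
    · refine (finite_Iic (m + 1)).subset ?_
      rintro n ⟨v, hv, hvz⟩
      by_contra hn
      obtain ⟨a, ha, hua⟩ := hs4 m u hu
      obtain ⟨c, hc, hvc⟩ := hs4 n v hv
      have h1 := hsep m n (by simp at hn; lia) a ha c hc
      have h2 := dist_triangle4 a u z c
      have h3 := dist_triangle z v c
      rw [mem_ball] at huz hvz
      rw [dist_comm] at hua hvz
      linarith
  have hγs : ∀ t, 0 ≤ t → t < ∑ᶠ n, s n (γ t) := by
    intro t ht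
    calc t < ⌊t⌋₊ + 2 := (Nat.lt_floor_add_one t).trans (by linarith)
      _ ≤ s ⌊t⌋₊ (γ t) := hs3 _ _ (hγm t ht)
      _ ≤ _ := single_le_finsum (f := fun n => s n (γ t)) ⌊t⌋₊ (hfin.point_finite (γ t))
        fun n => hs2 n _
  refine ⟨fun x => x - γ (∑ᶠ n, s n x), ?_, ?_, ?_⟩
  · exact contDiff_id.sub (hγ.comp (contDiff_finsum_of_locallyFinite hs1 hfin))
  · intro x hx
    have h := hγs (∑ᶠ n, s n x) (finsum_nonneg fun n => hs2 n x)
    rw [← sub_eq_zero.1 hx] at h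
    exact lt_irrefl _ h
  · intro x hx
    have : ∑ᶠ n, s n x = 0 := by
      refine finsum_eq_zero_of_forall_eq_zero fun n => ?_
      by_contra h
      obtain ⟨a, ha, hxa⟩ := hs4 n x h
      have h1 : a ∈ closedBall (0 : X) 3 :=
        (convex_closedBall 0 3).segment_subset (by simpa using hy n) (by simpa using hy (n + 1)) ha
      rw [mem_closedBall_zero_iff] at h1
      rw [dist_eq_norm] at hxa
      have h2 := norm_le_norm_add_norm_sub' x a
      linarith
    simp only
    rw [this, hγ0, sub_zero]

end Path

/-! ### Starlike bodies, their Minkowski functionals and radial projection. -/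

section Starlike

variable {X : Type*} [NormedAddCommGroup X] [NormedSpace ℝ X] {A : Set X} {x₀ : X}

/-- Leaving `A` and re-entering it along a ray would produce two distinct boundary points on that
ray. -/
theorem IsStarlikeBodyWrt.starConvex (h : IsStarlikeBodyWrt A x₀) :
    StarConvex ℝ 0 {v : X | x₀ + v ∈ A} := by
  rw [starConvex_zero_iff]
  intro v hv a ha0 ha1
  by_contra hav
  let g : ℝ → X := fun t => x₀ + t • v
  have hg : Continuous g := by fun_prop
  have h0 : (0 : ℝ) ∈ g ⁻¹' A := by simpa [g] using interior_subset h.mem_interior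
  have h1 : (1 : ℝ) ∈ g ⁻¹' A := by simpa [g] using hv
  have hcl : IsClosed (g ⁻¹' A) := h.isClosed.preimage hg
  have hfr : ∀ c d, c ≤ a → a ≤ d → (c ∈ g ⁻¹' A ∨ d ∈ g ⁻¹' A) →
      ∃ t ∈ Icc c d, t ≠ a ∧ g t ∈ frontier A := by
    intro c d hc hd hcd
    have hne : (Icc c d ∩ g ⁻¹' A).Nonempty := by
      rcases hcd with h' | h'
      · exact ⟨c, ⟨le_rfl, hc.trans hd⟩, h'⟩
      · exact ⟨d, ⟨hc.trans hd, le_rfl⟩, h'⟩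
    obtain ⟨t, ht, htf⟩ := isPreconnected_Icc.inter_frontier_nonempty hne ⟨a, ⟨hc, hd⟩, hav⟩
    refine ⟨t, ht, ?_, hg.frontier_preimage_subset A htf⟩
    rintro rfl
    exact hav (hcl.frontier_subset htf)
  obtain ⟨t, ht, hta, htf⟩ := hfr 0 a ha0 le_rfl (Or.inl h0)
  obtain ⟨u, hu, hua, huf⟩ := hfr a 1 le_rfl ha1 (Or.inr h1)
  have htu : t < u := (lt_of_le_of_ne ht.2 hta).trans_le hu.1
  have heq : g t = g u := h.ray_inter v ⟨⟨t, ht.1, rfl⟩, htf⟩ ⟨⟨u, ha0.trans hu.1, rfl⟩, huf⟩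
  have hv0 : v = 0 := by
    have : (u - t) • v = 0 := by
      rw [sub_smul, sub_eq_zero]
      exact (add_left_cancel heq).symm
    exact (smul_eq_zero.1 this).resolve_left (sub_ne_zero.2 htu.ne')
  exact hav (by simpa [hv0, g] using h0)

theorem IsStarlikeBodyWrt.mem_nhds_zero (h : IsStarlikeBodyWrt A x₀) :
    {v : X | x₀ + v ∈ A} ∈ 𝓝 0 := by
  have hc : Tendsto (fun v : X => x₀ + v) (𝓝 0) (𝓝 x₀) := by
    simpa using (continuous_const_add x₀).tendsto 0
  exact hc (mem_interior_iff_mem_nhds.1 h.mem_interior)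

theorem minkowskiAt_smul (A : Set X) (x₀ : X) {t : ℝ} (ht : 0 ≤ t) (v : X) :
    minkowskiAt A x₀ (t • v) = t * minkowskiAt A x₀ v :=
  gauge_smul_of_nonneg ht v

theorem IsStarlikeBodyWrt.exists_minkowskiAt_le (h : IsStarlikeBodyWrt A x₀) :
    ∃ C, 0 < C ∧ ∀ v, minkowskiAt A x₀ v ≤ C * ‖v‖ := by
  obtain ⟨r, hr, hrA⟩ := Metric.mem_nhds_iff.1 h.mem_nhds_zero
  refine ⟨r⁻¹, inv_pos.2 hr, fun v => ?_⟩
  rw [inv_mul_eq_div, le_div_iff₀ hr, mul_comm]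
  exact mul_gauge_le_norm hrA

theorem IsStarlikeBodyWrt.exists_norm_le_minkowskiAt (h : IsStarlikeBodyWrt A x₀)
    (hA : Bornology.IsBounded A) : ∃ M, 0 < M ∧ ∀ v, ‖v‖ ≤ M * minkowskiAt A x₀ v := by
  obtain ⟨M, hM⟩ := hA.subset_closedBall x₀
  refine ⟨max M 1, by positivity, fun v => ?_⟩
  have hpos : 0 < max M 1 := by positivity
  rw [mul_comm, ← div_le_iff₀ hpos]
  refine le_gauge_of_subset_closedBall (absorbent_nhds_zero h.mem_nhds_zero) hpos.le fun w hw => ?_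
  have := hM hw
  rw [mem_closedBall, dist_eq_norm, add_sub_cancel_left] at this
  exact mem_closedBall_zero_iff.2 (this.trans (le_max_left _ _))

theorem IsStarlikeBodyWrt.minkowskiAt_ne_zero (h : IsStarlikeBodyWrt A x₀)
    (hA : Bornology.IsBounded A) {v : X} (hv : v ≠ 0) : minkowskiAt A x₀ v ≠ 0 := by
  obtain ⟨M, _, hM⟩ := h.exists_norm_le_minkowskiAt hA
  intro h0
  have := hM v
  rw [h0, mul_zero] at this
  exact hv (norm_le_zero_iff.1 this)

theorem IsStarlikeBodyWrt.minkowskiAt_pos (h : IsStarlikeBodyWrt A x₀)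
    (hA : Bornology.IsBounded A) {v : X} (hv : v ≠ 0) : 0 < minkowskiAt A x₀ v :=
  lt_of_le_of_ne (gauge_nonneg v) (h.minkowskiAt_ne_zero hA hv).symm

/-- Gauge below `1` is star convexity; the value `1` follows by letting `t → 1` in `t • v`, as `A`
is closed. -/
theorem IsStarlikeBodyWrt.add_mem_of_minkowskiAt_le_one (h : IsStarlikeBodyWrt A x₀) {v : X}
    (hv : minkowskiAt A x₀ v ≤ 1) : x₀ + v ∈ A := by
  have hlt : ∀ w, minkowskiAt A x₀ w < 1 → x₀ + w ∈ A := by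
    intro w hw
    obtain ⟨b, hb0, hb1, u, hu, rfl⟩ :=
      exists_lt_of_gauge_lt (absorbent_nhds_zero h.mem_nhds_zero) hw
    exact starConvex_zero_iff.1 h.starConvex hu hb0.le hb1.le
  have hcont : Continuous fun t : ℝ => x₀ + t • v := by fun_prop
  have hcl : IsClosed {t : ℝ | x₀ + t • v ∈ A} := h.isClosed.preimage hcont
  have hsub : Ioo (0 : ℝ) 1 ⊆ {t : ℝ | x₀ + t • v ∈ A} := by
    intro t ht
    refine hlt _ ?_
    rw [minkowskiAt_smul A x₀ ht.1.le]
    nlinarith [ht.1, ht.2]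
  have h1 : (1 : ℝ) ∈ closure (Ioo (0 : ℝ) 1) := by
    rw [closure_Ioo zero_ne_one]
    exact right_mem_Icc.2 zero_le_one
  simpa using hcl.closure_subset_iff.2 hsub h1

theorem IsStarlikeBodyWrt.add_mem_frontier (h : IsStarlikeBodyWrt A x₀) {v : X}
    (hv : minkowskiAt A x₀ v = 1) : x₀ + v ∈ frontier A := by
  refine ⟨subset_closure (h.add_mem_of_minkowskiAt_le_one hv.le), fun hint => ?_⟩
  have hmem : v ∈ interior {v : X | x₀ + v ∈ A} :=
    preimage_interior_subset_interior_preimage (continuous_const_add x₀) hint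
  exact (interior_subset_gauge_lt_one _ hmem).ne hv

theorem IsStarlikeBodyWrt.minkowskiAt_eq_one (h : IsStarlikeBodyWrt A x₀)
    (hq : Continuous (minkowskiAt A x₀)) {x : X} (hx : x ∈ frontier A) :
    minkowskiAt A x₀ (x - x₀) = 1 := by
  refine le_antisymm (gauge_le_one_of_mem ?_) (not_lt.1 fun hlt => hx.2 ?_)
  · simpa using h.isClosed.frontier_subset hx
  · refine _root_.mem_interior.2 ⟨{z | minkowskiAt A x₀ (z - x₀) < 1}, fun z hz => ?_,
      isOpen_lt (by fun_prop) continuous_const, hlt⟩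
    simpa using h.add_mem_of_minkowskiAt_le_one (le_of_lt hz)

variable {p : ℕ∞}

theorem IsStarlikeBodyWrt.contDiffAt_minkowskiAt (h : IsStarlikeBodyWrt A x₀)
    (hA : Bornology.IsBounded A)
    (hp : ContDiffOn ℝ p (minkowskiAt A x₀) {v : X | minkowskiAt A x₀ v ≠ 0}) {v : X}
    (hv : v ≠ 0) : ContDiffAt ℝ p (minkowskiAt A x₀) v :=
  hp.contDiffAt <| mem_of_superset (isOpen_ne.mem_nhds hv) fun _ hw =>
    h.minkowskiAt_ne_zero hA hw

theorem IsStarlikeBodyWrt.continuous_minkowskiAt (h : IsStarlikeBodyWrt A x₀)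
    (hA : Bornology.IsBounded A)
    (hp : ContDiffOn ℝ p (minkowskiAt A x₀) {v : X | minkowskiAt A x₀ v ≠ 0}) :
    Continuous (minkowskiAt A x₀) := by
  rw [continuous_iff_continuousAt]
  intro v
  by_cases hv : v = 0
  · rw [hv]
    exact continuousAt_gauge_zero h.mem_nhds_zero
  · exact (h.contDiffAt_minkowskiAt hA hp hv).continuousAt

theorem IsStarlikeBodyWrt.hasCpBump (h : IsStarlikeBodyWrt A x₀) (hA : Bornology.IsBounded A)
    (hp : ContDiffOn ℝ p (minkowskiAt A x₀) {v : X | minkowskiAt A x₀ v ≠ 0}) :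
    HasCpBump X p := by
  obtain ⟨M, hM, hMq⟩ := h.exists_norm_le_minkowskiAt hA
  have hq := h.continuous_minkowskiAt hA hp
  have hnear : ∀ᶠ x in 𝓝 (0 : X),
      Real.smoothTransition (2 - 2 * M * minkowskiAt A x₀ x) = 1 := by
    have h0 : minkowskiAt A x₀ 0 = 0 := gauge_zero
    have hc : Continuous fun x => 2 * M * minkowskiAt A x₀ x := by fun_prop
    filter_upwards [hc.continuousAt.eventually_lt (continuousAt_const (y := (1 : ℝ)))
      (by simp [h0])] with x hx
    exact Real.smoothTransition.one_of_one_le (by linarith)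
  refine ⟨fun x => Real.smoothTransition (2 - 2 * M * minkowskiAt A x₀ x), ?_,
    fun x => Real.smoothTransition.nonneg _, hnear, ?_⟩
  -- The function is constant near `0`, which hides the possible non-smoothness of the gauge there.
  · rw [contDiff_iff_contDiffAt]
    intro v
    by_cases hv : v = 0
    · rw [hv]
      exact (contDiffAt_const (c := (1 : ℝ))).congr_of_eventuallyEq hnear
    · exact Real.smoothTransition.contDiff.contDiffAt.comp v
        (contDiffAt_const.sub (contDiffAt_const.mul (h.contDiffAt_minkowskiAt hA hp hv)))
  · intro x hx
    have : 0 < 2 - 2 * M * minkowskiAt A x₀ x := by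
      by_contra! hle
      exact hx (Real.smoothTransition.zero_of_nonpos hle)
    nlinarith [hMq x]

/-- The radial projection of `X \ {x₀}` onto the boundary of a starlike body, in terms of the
displacement from the centre. -/
noncomputable def radialProj (A : Set X) (x₀ v : X) : X :=
  x₀ + (minkowskiAt A x₀ v)⁻¹ • v

theorem IsStarlikeBodyWrt.radialProj_mem (h : IsStarlikeBodyWrt A x₀)
    (hA : Bornology.IsBounded A) {v : X} (hv : v ≠ 0) : radialProj A x₀ v ∈ frontier A := by
  refine h.add_mem_frontier ?_
  have := h.minkowskiAt_pos hA hv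
  rw [minkowskiAt_smul A x₀ (inv_nonneg.2 this.le), inv_mul_cancel₀ this.ne']

theorem IsStarlikeBodyWrt.contDiff_radialProj_comp (h : IsStarlikeBodyWrt A x₀)
    (hA : Bornology.IsBounded A)
    (hp : ContDiffOn ℝ p (minkowskiAt A x₀) {v : X | minkowskiAt A x₀ v ≠ 0})
    {E : Type*} [NormedAddCommGroup E] [NormedSpace ℝ E] {f : E → X} (hf : ContDiff ℝ p f)
    (hf0 : ∀ x, f x ≠ 0) : ContDiff ℝ p fun x => radialProj A x₀ (f x) := by
  rw [contDiff_iff_contDiffAt]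
  intro x
  have hq : ContDiffAt ℝ p (fun x => minkowskiAt A x₀ (f x)) x :=
    (h.contDiffAt_minkowskiAt hA hp (hf0 x)).comp x hf.contDiffAt
  exact contDiffAt_const.add
    ((hq.inv (h.minkowskiAt_ne_zero hA (hf0 x))).smul hf.contDiffAt)

/-- A bounded `C^p` smooth starlike body in an infinite-dimensional space retracts onto its
boundary by a map which is defined and `C^p` on the whole space. -/
theorem IsStarlikeBodyWrt.exists_contDiff_retraction (hX : ¬ FiniteDimensional ℝ X)
    (h : IsStarlikeBodyWrt A x₀) (hA : Bornology.IsBounded A)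
    (hp : ContDiffOn ℝ p (minkowskiAt A x₀) {v : X | minkowskiAt A x₀ v ≠ 0}) :
    ∃ R : X → X, ContDiff ℝ p R ∧ (∀ x, R x ∈ frontier A) ∧ ∀ x ∈ frontier A, R x = x := by
  obtain ⟨f, hf, hf0, hfe⟩ := exists_contDiff_ne_zero_eq_self hX (h.hasCpBump hA hp)
  obtain ⟨C, hC, hqC⟩ := h.exists_minkowskiAt_le
  have hg0 : ∀ x, f ((4 * C) • (x - x₀)) ≠ 0 := fun x => hf0 _
  -- On the boundary `1 ≤ C * ‖x - x₀‖`, so scaling by `4 * C` moves it to where `f` is the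
  -- identity.
  refine ⟨fun x => radialProj A x₀ ((4 * C)⁻¹ • f ((4 * C) • (x - x₀))), ?_, ?_, ?_⟩
  · refine h.contDiff_radialProj_comp hA hp ?_ fun x => smul_ne_zero (by positivity) (hg0 x)
    exact contDiff_const.smul (hf.comp (contDiff_const.smul (contDiff_id.sub contDiff_const)))
  · exact fun x => h.radialProj_mem hA (smul_ne_zero (by positivity) (hg0 x))
  · intro x hx
    have h1 := h.minkowskiAt_eq_one (h.continuous_minkowskiAt hA hp) hx
    have h2 : 4 ≤ ‖(4 * C) • (x - x₀)‖ := by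
      rw [norm_smul, Real.norm_of_nonneg (by positivity)]
      nlinarith [hqC (x - x₀)]
    dsimp only
    rw [hfe _ h2, inv_smul_smul₀ (by positivity), radialProj, h1, inv_one, one_smul,
      add_sub_cancel]

end Starlike

/-! ### The three conclusions. -/

theorem ContDiff.isCpOn {E F : Type*} [NormedAddCommGroup E] [NormedSpace ℝ E]
    [NormedAddCommGroup F] [NormedSpace ℝ F] {p : ℕ∞} {f : E → F} (hf : ContDiff ℝ p f)
    (S : Set E) : IsCpOn p f S :=
  ⟨univ, isOpen_univ, subset_univ S, hf.contDiffOn⟩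

theorem corollary3p2 {X : Type*} [NormedAddCommGroup X] [NormedSpace ℝ X] [CompleteSpace X]
    (hX : ¬ FiniteDimensional ℝ X) (p : ℕ∞) (A : Set X)
    (hA : IsSmoothStarlikeBody p A) (hbdd : Bornology.IsBounded A) :
    IsCpContractible p (frontier A) ∧
    (∃ R : X → X, IsCpRetraction p R A (frontier A)) ∧
    (∃ φ : X → X, IsCpOn p φ A ∧ Set.MapsTo φ A A ∧ ∀ x ∈ A, φ x ≠ x) := by
  obtain ⟨x₀, h, hp⟩ := hA
  obtain ⟨R, hR, hRm, hRe⟩ := h.exists_contDiff_retraction hX hbdd hp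
  have hsub : frontier A ⊆ A := h.isClosed.frontier_subset
  have hq : ∀ x ∈ frontier A, x - x₀ ≠ 0 := by
    intro x hx h0
    have h1 := h.minkowskiAt_eq_one (h.continuous_minkowskiAt hbdd hp) hx
    rw [h0, minkowskiAt, gauge_zero] at h1
    exact zero_ne_one h1
  have hneg : ∀ x, -(R x - x₀) ≠ 0 := fun x => neg_ne_zero.2 (hq _ (hRm x))
  refine ⟨?_, ⟨R, hsub, hR.isCpOn A, fun x _ => hRm x, hRe⟩, ?_⟩
  · refine ⟨fun z => R (z.2 + z.1 • (x₀ - z.2)), R x₀, hRm x₀, ContDiff.isCpOn ?_ _,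
      fun z _ => hRm _, fun x hx => ?_, fun x _ => ?_⟩
    · exact hR.comp (contDiff_snd.add (contDiff_fst.smul (contDiff_const.sub contDiff_snd)))
    · simpa using hRe x hx
    · simp
  · refine ⟨fun x => radialProj A x₀ (-(R x - x₀)), ContDiff.isCpOn ?_ _,
      fun x _ => hsub (h.radialProj_mem hbdd (hneg x)), fun x _ hx => ?_⟩
    · exact h.contDiff_radialProj_comp hbdd hp (hR.sub contDiff_const).neg hneg
    -- A fixed point lies on the boundary, so `R` fixes it; then `x - x₀` is a negative multiple of
    -- itself, forcing `x = x₀`.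
    · have hxf : x ∈ frontier A := hx ▸ h.radialProj_mem hbdd (hneg x)
      dsimp only at hx
      have hpos := h.minkowskiAt_pos hbdd (hneg x)
      rw [hRe x hxf] at hx hpos
      set c := (minkowskiAt A x₀ (-(x - x₀)))⁻¹ with hc
      have hcpos : 0 < c := inv_pos.2 hpos
      have hzero : (1 + c) • (x - x₀) = 0 := by
        have : x - x₀ = c • -(x - x₀) := by
          conv_lhs => rw [← hx]
          rw [radialProj, add_sub_cancel_left]
        rw [add_smul, one_smul]
        nth_rewrite 1 [this]
        rw [smul_neg, neg_add_cancel]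
      exact hq x hxf ((smul_eq_zero.1 hzero).resolve_left (by positivity))
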